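/- **Setting.** In random-order Unit Interval Selection the input is a set $S$ of $n$ distinct closed unit-length intervals $[a,a+1]$ on the real line, presented one at a time in a uniformly random order; the task is to output an independent (pairwise disjoint) subset of $S$ that is as large as possible. Let $\alpha(S)=|OPT|$ denote the largest size of an independent subset of $S$. Every endpoint is assumed to be storable in $O(\log n)$ bits: for a fixed integer $\kappa\ge 2$, all left endpoints are rationals whose numerator and denominator have absolute value at most $n^{\kappa}$. The approximation factor of an output $I$ is $|I|/\alpha(S)$ if $I$ is an independent subset of $S$, and $0$ otherwise; $I$ is a $\beta$-approximation if it is an independent subset of $S$ with $|I|\ge\beta\,\alpha(S)$. A randomized one-pass streaming algorithm for inputs of size $n$ holds a bit string as its memory content, updates it at each arrival as a function of the current content, the arriving interval, the time and its random choices, and finally computes its output from the last memory content (and its random choices). Its space is the length in bits of the memory content; access to random bits and to the time is free. **Theorem.** Let $\epsilon>0$. There are a constant $c>0$ and an integer $N$, depending only on $\epsilon$, such that for all $n\ge N$ and all $\kappa\ge 2$ the following hold. 1. Any randomized one-pass streaming algorithm for random-order Unit Interval Selection with expected approximation factor at least $8/9+\epsilon$ on every instance of size $n$ must use at least $cn=\Omega(n)$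 bits of space. 2. For every $\delta>0$, any randomized one-pass streaming algorithm for random-order Unit Interval Selection that on every instance of size $n$ outputs a $(2/3+\delta)$-approximation with probability at least $2/3+\epsilon$ must use at least $cn=\Omega(n)$ bits of space. The expectation in (1) and the probability in (2) are taken over both the stream order and the random choices of the algorithm. In both cases the space bound is already attained on instances with a constant-size optimum: there is an instance $S$ of size $n$ with $\alpha(S)=3$ and an arrival order of $S$ for which, at some time, the memory content has at least $cn$ bits with positive probability. -/

import Mathlib

open MeasureTheory

noncomputable section

namespace IntervalSelection

/-! ### Unit Interval Selection

A closed unit-length interval on the line is represented by its left endpoint. -/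

/-- The closed unit-length interval `[a, a + 1]` of the real line. -/
def closedUnitInterval (a : ℚ) : Set ℝ := Set.Icc (a : ℝ) ((a : ℝ) + 1)

/-- A set of intervals is independent if its intervals are pairwise disjoint. -/
def Independent (I : Finset ℚ) : Prop :=
  (I : Set ℚ).PairwiseDisjoint closedUnitInterval

/-- `I` is a valid solution for the input `S`: an independent subset of the input intervals. -/
def Feasible (S I : Finset ℚ) : Prop := I ⊆ S ∧ Independent I

open Classical in
/-- The size `α(S) = |OPT|` of a largest independent subset of `S`. -/
def alpha (S : Finset ℚ) : ℕ := (S.powerset.filter Independent).sup Finset.card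

/-- `I` is a `β`-approximation for `S`: a valid solution with `|I| ≥ β |OPT|`. -/
def IsApproximation (β : ℝ) (S I : Finset ℚ) : Prop :=
  Feasible S I ∧ β * (alpha S : ℝ) ≤ (I.card : ℝ)

open Classical in
/-- The approximation factor `|I| / |OPT|` achieved by the output `I` on input `S`
(zero if the output is not a valid solution). -/
def approxFactor (S I : Finset ℚ) : ℝ :=
  if Feasible S I then (I.card : ℝ) / (alpha S : ℝ) else 0

/-- An input instance: `n` distinct closed unit intervals, listed in an arbitrary way, whose
endpoints can be written down with `O(log n)` bits (numerator and denominator of the left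
endpoint are at most `n ^ κ`). -/
structure Instance (κ n : ℕ) where
  /-- the left endpoints of the intervals -/
  left : Fin n ↪ ℚ
  num_le : ∀ i, |(left i).num| ≤ (n : ℤ) ^ κ
  den_le : ∀ i, (left i).den ≤ n ^ κ

/-- The set of intervals of an instance. -/
def Instance.intervals {κ n : ℕ} (x : Instance κ n) : Finset ℚ := Finset.univ.map x.left

/-- The stream that presents the intervals of `x` in the order given by `σ`. -/
def Instance.stream {κ n : ℕ} (x : Instance κ n) (σ : Equiv.Perm (Fin n)) : Fin n → ℚ :=
  fun i => x.left (σ i)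

/-! ### Randomized one-pass streaming algorithms -/

/-- A randomized one-pass streaming algorithm with source of randomness `Ω`. Its memory content
is a string of bits. The number of the current arrival and the random source may be consulted
freely and are not charged as space. -/
structure StreamingAlgorithm (Ω : Type*) [MeasurableSpace Ω] where
  /-- the initial memory content -/
  init : List Bool
  /-- `step k ω q a` is the memory content after the arrival (at time `k`) of the interval with
  left endpoint `a`, when the memory content before was `q` -/
  step : ℕ → Ω → List Bool → ℚ → List Bool
  /-- the set of intervals that is output at the end, read off the final memory content -/
  output : Ω → List Bool → Finset ℚ
  measurableSet_step : ∀ k q a r, MeasurableSet {ω | step k ω q a = r}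
  measurableSet_output : ∀ q I, MeasurableSet {ω | output ω q = I}

namespace StreamingAlgorithm

variable {Ω : Type*} [MeasurableSpace Ω]

/-- The memory content after the first `k` intervals of the stream `s` have been read. -/
def memory (A : StreamingAlgorithm Ω) {n : ℕ} (s : Fin n → ℚ) (ω : Ω) : ℕ → List Bool
  | 0 => A.init
  | k + 1 => if h : k < n then A.step k ω (A.memory s ω k) (s ⟨k, h⟩) else A.memory s ω k

/-- The output of the algorithm on the stream `s`. -/
def result (A : StreamingAlgorithm Ω) {n : ℕ} (s : Fin n → ℚ) (ω : Ω) : Finset ℚ :=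
  A.output ω (A.memory s ω n)

/-- The probability that the output is a `β`-approximation, over a uniform random arrival order
and the random choices of the algorithm. -/
def successProb (A : StreamingAlgorithm Ω) (P : Measure Ω) {κ n : ℕ} (β : ℝ)
    (x : Instance κ n) : ℝ :=
  (∑ σ : Equiv.Perm (Fin n),
    P.real {ω | IsApproximation β x.intervals (A.result (x.stream σ) ω)}) / (n.factorial : ℝ)

/-- The expected approximation factor, over a uniform random arrival order and the random choices
of the algorithm. -/
def expectedFactor (A : StreamingAlgorithm Ω) (P : Measure Ω) {κ n : ℕ}
    (x : Instance κ n) : ℝ :=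
  (∑ σ : Equiv.Perm (Fin n),
    ∫ ω, approxFactor x.intervals (A.result (x.stream σ) ω) ∂P) / (n.factorial : ℝ)

/-- On the instance `x` the algorithm uses at least `b` bits of space: for some arrival order, at
some time, the memory content has at least `b` bits with positive probability. -/
def UsesSpaceAtLeast (A : StreamingAlgorithm Ω) (P : Measure Ω) {κ n : ℕ}
    (x : Instance κ n) (b : ℝ) : Prop :=
  ∃ σ : Equiv.Perm (Fin n), ∃ k ≤ n,
    0 < P {ω | b ≤ ((A.memory (x.stream σ) ω k).length : ℝ)}

end StreamingAlgorithm

end IntervalSelection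

end

/-! The hard inputs consist of a clique of `m = n - 2` intervals, whose left endpoints lie one in
each of `m` consecutive short blocks, and two outer intervals. The offset inside block `i` is a
letter `v i` from an alphabet of size `2 ^ k`. The outer intervals are placed so that only clique
interval `j` fits between them. An optimal solution has size three and must contain clique interval
`j`, so it reveals `v j` (`letter_eq_of_card_eq_three`); every other solution has size at most two.

In a random order, clique interval `j` precedes both outer intervals with probability 1/3. In that
case it has to be remembered before `j` is known, because the stream up to the first outer interval
does not depend on `j`. Fix the order and the random choices, and let `G` be the set of such early
`j` for which the algorithm would succeed. The memory content at that moment, the set `G` and the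
letters off `G` together determine `v`. With `O(m)` bits for the memory content and `G`, only `O(m /
k)` letters of `k` bits can be recovered, so `G` has average size at most `(3m + 1) / k`
(`mul_sum_card_le`, `mul_sum_card_earlyFound_le`).

Conceding all late `j`, a solution of size three is found with average probability at most `2/3 +
(3m + 1) / (km)`, which is below `2/3 + ε` once `k > 4 / ε`. Averaging over words, marked positions
and random choices yields one bad instance (`exists_probFindsThree_lt`). Since a run that misses
size three has factor at most 2/3, the expected factor there is below `2/3 + (2/3 + ε) / 3 = 8/9 + ε
/ 3`. -/

namespace IntervalSelection

/-! ### Counting -/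

/-- The number of words over an alphabet of size `K` whose state and set of marked letters are
prescribed, if these data and the unmarked letters determine the word. -/
theorem card_mul_pow_le_pow {m K : ℕ} {Q : Type*} [DecidableEq Q]
    (f : (Fin m → Fin K) → Q) (G : (Fin m → Fin K) → Finset (Fin m))
    (h : ∀ v v', f v = f v' → G v = G v' → (∀ j ∉ G v, v j = v' j) → v = v')
    (q : Q) (A : Finset (Fin m)) :
    (Finset.univ.filter fun v => f v = q ∧ G v = A).card * K ^ A.card ≤ K ^ m := by
  have h1 : (Finset.univ.filter fun v => f v = q ∧ G v = A).card ≤ K ^ (m - A.card) := by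
    have hc : Fintype.card ({j // j ∉ A} → Fin K) = K ^ (m - A.card) := by
      simp [Fintype.card_subtype_compl]
    rw [← hc, ← Finset.card_univ]
    refine Finset.card_le_card_of_injOn (fun v j => v j.1) (fun _ _ => Finset.mem_coe.2 (Finset.mem_univ _)) ?_
    intro v hv v' hv' hvv
    simp only [Finset.coe_filter, Finset.mem_univ, true_and, Set.mem_ofPred_eq] at hv hv'
    refine h v v' (hv.1.trans hv'.1.symm) (hv.2.trans hv'.2.symm) fun j hj => ?_
    rw [hv.2] at hj
    exact congrFun hvv ⟨j, hj⟩
  have hA : A.card ≤ m := by simpa using Finset.card_le_univ A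
  calc _ ≤ K ^ (m - A.card) * K ^ A.card := Nat.mul_le_mul_right _ h1
    _ = K ^ m := by rw [← pow_add, Nat.sub_add_cancel hA]

/-- Sort the words by the pair (state, marked set): each of the `|Q| * 2 ^ m` classes contributes at
most `K ^ m`. -/
theorem sum_pow_card_le {m K : ℕ} {Q : Type*} [Fintype Q] [DecidableEq Q]
    (f : (Fin m → Fin K) → Q) (G : (Fin m → Fin K) → Finset (Fin m))
    (h : ∀ v v', f v = f v' → G v = G v' → (∀ j ∉ G v, v j = v' j) → v = v') :
    ∑ v, K ^ (G v).card ≤ Fintype.card Q * 2 ^ m * K ^ m := by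
  calc ∑ v, K ^ (G v).card
      = ∑ p : Q × Finset (Fin m), ∑ v with (f v, G v) = p, K ^ (G v).card :=
        (Finset.sum_fiberwise _ _ _).symm
    _ ≤ ∑ _p : Q × Finset (Fin m), K ^ m := by
        refine Finset.sum_le_sum fun p _ => ?_
        refine le_trans (le_of_eq ?_) (card_mul_pow_le_pow f G h p.1 p.2)
        rw [← smul_eq_mul, ← Finset.sum_const]
        refine Finset.sum_congr (by ext v; simp [Prod.ext_iff]) fun v hv => ?_
        simp only [Finset.mem_filter] at hv
        rw [hv.2.2]
    _ = Fintype.card Q * 2 ^ m * K ^ m := by simp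

/-- Passes from the exponential moment of `|G|` to its mean. The quantity `3m` is the binary
logarithm of `4 ^ m * 2 ^ m`. -/
theorem mul_sum_card_le {m k : ℕ} {Q : Type*} [Fintype Q] [DecidableEq Q]
    (hQ : Fintype.card Q ≤ 4 ^ m)
    (f : (Fin m → Fin (2 ^ k)) → Q) (G : (Fin m → Fin (2 ^ k)) → Finset (Fin m))
    (h : ∀ v v', f v = f v' → G v = G v' → (∀ j ∉ G v, v j = v' j) → v = v') :
    k * ∑ v, (G v).card ≤ (3 * m + 1) * (2 ^ k) ^ m := by
  -- This is `kx ≤ 3m + 2 ^ (kx - 3m)` with the denominator cleared, a linear substitute for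
  -- Jensen's inequality. The last term averages to at most 1, which gives the `+ 1` in the bound.
  have hx : ∀ x : ℕ, k * x * 2 ^ (3 * m) ≤ 3 * m * 2 ^ (3 * m) + (2 ^ k) ^ x := by
    intro x
    rw [← pow_mul]
    rcases le_total (k * x) (3 * m) with hle | hle
    · exact (Nat.mul_le_mul_right _ hle).trans (Nat.le_add_right _ _)
    · obtain ⟨d, hd⟩ := Nat.exists_eq_add_of_le hle
      rw [hd, add_mul, pow_add]
      have := (Nat.lt_two_pow_self (n := d)).le
      nlinarith [Nat.mul_le_mul_left (2 ^ (3 * m)) this]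
  have hsum := sum_pow_card_le f G h
  have hpos : 0 < 2 ^ (3 * m) := by positivity
  refine Nat.le_of_mul_le_mul_right ?_ hpos
  calc k * (∑ v, (G v).card) * 2 ^ (3 * m)
      = ∑ v, k * (G v).card * 2 ^ (3 * m) := by rw [Finset.mul_sum, Finset.sum_mul]
    _ ≤ ∑ v, (3 * m * 2 ^ (3 * m) + (2 ^ k) ^ (G v).card) := Finset.sum_le_sum fun v _ => hx _
    _ = (2 ^ k) ^ m * (3 * m * 2 ^ (3 * m)) + ∑ v, (2 ^ k) ^ (G v).card := by
        rw [Finset.sum_add_distrib]; simp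
    _ ≤ (2 ^ k) ^ m * (3 * m * 2 ^ (3 * m)) + 4 ^ m * 2 ^ m * (2 ^ k) ^ m := by
        gcongr
        exact hsum.trans (by gcongr)
    _ = (3 * m + 1) * (2 ^ k) ^ m * 2 ^ (3 * m) := by
        rw [← mul_pow, pow_mul 2 3 m]; norm_num; ring

/-- Among three distinct elements, a given one comes first in a third of all orders. -/
theorem three_mul_card_not_first_le {n : ℕ} {a b c : Fin n} (hab : a ≠ b) (hac : a ≠ c)
    (hbc : b ≠ c) :
    3 * (Finset.univ.filter fun σ : Equiv.Perm (Fin n) =>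
      ¬ (σ.symm a < σ.symm b ∧ σ.symm a < σ.symm c)).card ≤ 2 * n.factorial := by
  classical
  let F : Fin n → Fin n → Fin n → Finset (Equiv.Perm (Fin n)) := fun x y z =>
    Finset.univ.filter fun σ => σ.symm x < σ.symm y ∧ σ.symm x < σ.symm z
  -- Exchanging the arrival times of `x` and `y` turns orders with `x` first into orders with `y`
  -- first. Only the comparisons with `a` are needed afterwards.
  have key : ∀ x y z : Fin n, x ≠ z → y ≠ z → (F x y z).card ≤ (F y x z).card := by
    intro x y z hxz hyz
    refine Finset.card_le_card_of_injOn (fun σ => Equiv.swap x y * σ) ?_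
      (fun _ _ _ _ h => mul_left_cancel h)
    intro σ hσ
    have e : ∀ w, (Equiv.swap x y * σ).symm w = σ.symm (Equiv.swap x y w) := by
      intro w
      rw [Equiv.symm_apply_eq]
      simp
    simp only [F, Finset.coe_filter, Finset.mem_univ, true_and, Set.mem_ofPred_eq, e,
      Equiv.swap_apply_left, Equiv.swap_apply_right,
      Equiv.swap_apply_of_ne_of_ne hxz.symm hyz.symm] at hσ ⊢
    exact hσ
  have hb : (F b a c).card ≤ (F a b c).card := key b a c hbc hac
  have hc : (F c a b).card ≤ (F a b c).card := by
    have := key c a b hbc.symm hab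
    have e : F a c b = F a b c := by ext σ; simp [F, and_comm]
    rwa [e] at this
  have hcard : (Finset.univ : Finset (Equiv.Perm (Fin n))).card = n.factorial := by
    rw [Finset.card_univ, Fintype.card_perm, Fintype.card_fin]
  have hsplit := Finset.card_filter_add_card_filter_not (s := (Finset.univ : Finset (Equiv.Perm (Fin n))))
    (fun σ => σ.symm a < σ.symm b ∧ σ.symm a < σ.symm c)
  have hcov : (Finset.univ.filter fun σ : Equiv.Perm (Fin n) =>
      ¬ (σ.symm a < σ.symm b ∧ σ.symm a < σ.symm c)) ⊆ F b a c ∪ F c a b := by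
    intro σ hσ
    have h1 : σ.symm a ≠ σ.symm b := fun h => hab (σ.symm.injective h)
    have h2 : σ.symm a ≠ σ.symm c := fun h => hac (σ.symm.injective h)
    have h3 : σ.symm b ≠ σ.symm c := fun h => hbc (σ.symm.injective h)
    simp only [F, Finset.mem_filter, Finset.mem_univ, true_and, Finset.mem_union] at hσ ⊢
    omega
  have h5 := (Finset.card_le_card hcov).trans (Finset.card_union_le _ _)
  change (F a b c).card + _ = _ at hsplit
  omega

/-! ### Memory contents -/

/-- The first `b` bits of a string. -/
def firstBits (b : ℕ) (l : List Bool) : Fin b → Option Bool := fun i => l[(i : ℕ)]?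

/-- Positions past the end read `none`, so the length of a short string is recorded as well. -/
theorem firstBits_injOn {b : ℕ} {l l' : List Bool} (hl : l.length ≤ b) (hl' : l'.length ≤ b)
    (h : firstBits b l = firstBits b l') : l = l' := by
  refine List.ext_getElem? fun i => ?_
  by_cases hi : i < b
  · exact congrFun h ⟨i, hi⟩
  · rw [List.getElem?_eq_none (by omega), List.getElem?_eq_none (by omega)]

namespace StreamingAlgorithm

variable {Ω : Type*} [MeasurableSpace Ω]

theorem memory_congr (A : StreamingAlgorithm Ω) {n : ℕ} {s s' : Fin n → ℚ} (ω : Ω) (k : ℕ)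
    (h : ∀ i : Fin n, (i : ℕ) < k → s i = s' i) : A.memory s ω k = A.memory s' ω k := by
  induction k with
  | zero => rfl
  | succ k ih =>
    simp only [memory]
    rw [ih fun i hi => h i (by omega)]
    split_ifs with hk
    · rw [h ⟨k, hk⟩ (Nat.lt_succ_self k)]
    · rfl

/-- The one-pass property: the past influences the future only through the current memory content.
-/
theorem memory_congr_of_le (A : StreamingAlgorithm Ω) {n : ℕ} {s s' : Fin n → ℚ} (ω : Ω)
    {t k : ℕ} (htk : t ≤ k) (ht : A.memory s ω t = A.memory s' ω t)
    (h : ∀ i : Fin n, t ≤ (i : ℕ) → s i = s' i) : A.memory s ω k = A.memory s' ω k := by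
  induction k, htk using Nat.le_induction with
  | base => exact ht
  | succ k hk ih =>
    simp only [memory]
    rw [ih]
    split_ifs with hn
    · rw [h ⟨k, hn⟩ hk]
    · rfl

/-- There are countably many bit strings, so one may split according to the previous memory content.
-/
theorem measurableSet_memory (A : StreamingAlgorithm Ω) {n : ℕ} (s : Fin n → ℚ) (k : ℕ)
    (r : List Bool) : MeasurableSet {ω | A.memory s ω k = r} := by
  induction k generalizing r with
  | zero => exact MeasurableSet.const (A.init = r)
  | succ k ih =>
    by_cases hk : k < n
    · have : {ω | A.memory s ω (k + 1) = r} =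
          ⋃ q : List Bool, {ω | A.memory s ω k = q} ∩ {ω | A.step k ω q (s ⟨k, hk⟩) = r} := by
        ext ω
        simp [memory, hk]
      rw [this]
      exact MeasurableSet.iUnion fun q => (ih q).inter (A.measurableSet_step _ _ _ _)
    · simpa [memory, hk] using ih r

theorem measurableSet_result (A : StreamingAlgorithm Ω) {n : ℕ} (s : Fin n → ℚ)
    (p : Finset ℚ → Prop) : MeasurableSet {ω | p (A.result s ω)} := by
  have : {ω | p (A.result s ω)} = ⋃ q : List Bool, ⋃ I : {I : Finset ℚ // p I},
      {ω | A.memory s ω n = q} ∩ {ω | A.output ω q = I.1} := by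
    ext ω
    simp [result]
  rw [this]
  exact MeasurableSet.iUnion fun q => MeasurableSet.iUnion fun I =>
    (A.measurableSet_memory s n q).inter (A.measurableSet_output _ _)

end StreamingAlgorithm

end IntervalSelection

namespace IntervalSelection

/-! ### The hard instances -/

theorem disjoint_closedUnitInterval_iff {a b : ℚ} :
    Disjoint (closedUnitInterval a) (closedUnitInterval b) ↔ 1 < |a - b| := by
  rw [closedUnitInterval, closedUnitInterval, Set.disjoint_iff_inter_eq_empty, Set.Icc_inter_Icc,
    Set.Icc_eq_empty_iff]
  have e : (1 < |a - b|) ↔ (1 : ℝ) < |(a : ℝ) - b| := by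
    rw [← Rat.cast_sub, ← Rat.cast_abs]; exact_mod_cast Iff.rfl
  rw [e, lt_abs, sup_le_iff, le_inf_iff, le_inf_iff]
  constructor
  · intro h
    by_contra! h'
    exact h ⟨⟨by linarith, by linarith⟩, by linarith, by linarith⟩
  · rintro (h | h) ⟨⟨h1, h2⟩, h3, h4⟩ <;> linarith

theorem Independent.eq_of_abs_sub_le {I : Finset ℚ} (hI : Independent I) {a b : ℚ} (ha : a ∈ I)
    (hb : b ∈ I) (hab : |a - b| ≤ 1) : a = b := by
  by_contra hne
  exact absurd (disjoint_closedUnitInterval_iff.1 (hI ha hb hne)) (not_lt.2 hab)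

/-- The left endpoints, as multiples of `1 / (m * (K + 1))`, of a clique of `m` intervals whose
exact positions are given by the word `v`, and of two intervals that are disjoint from each other
and from the clique interval `j` only. -/
def hardNumerator {K m : ℕ} (v : Fin m → Fin K) (j : Fin m) (i : Fin (m + 2)) : ℤ :=
  if h : (i : ℕ) < m then (i : ℤ) * (K + 1) + (v ⟨i, h⟩ : ℕ) + 1
  else if (i : ℕ) = m then (j : ℤ) * (K + 1) - m * (K + 1)
  else ((j : ℤ) + 1) * (K + 1) + m * (K + 1)

section

variable {K m : ℕ} (v : Fin m → Fin K) (j : Fin m)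

/-- The position of the clique interval `j` in the list of intervals. -/
def cliqueIndex (j : Fin m) : Fin (m + 2) := j.castAdd 2

/-- The position of the interval to the left of the marked clique interval. -/
def leftIndex (m : ℕ) : Fin (m + 2) := ⟨m, by omega⟩

/-- The position of the interval to the right of the marked clique interval. -/
def rightIndex (m : ℕ) : Fin (m + 2) := ⟨m + 1, by omega⟩

theorem hardNumerator_clique (i : Fin m) :
    hardNumerator v j (cliqueIndex i) = (i : ℤ) * (K + 1) + (v i : ℕ) + 1 := by
  simp [hardNumerator, cliqueIndex]

theorem hardNumerator_left :
    hardNumerator v j (leftIndex m) = (j : ℤ) * (K + 1) - m * (K + 1) := by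
  simp [hardNumerator, leftIndex]

theorem hardNumerator_right :
    hardNumerator v j (rightIndex m) = ((j : ℤ) + 1) * (K + 1) + m * (K + 1) := by
  simp [hardNumerator, rightIndex]

theorem index_cases (i : Fin (m + 2)) :
    (∃ l : Fin m, i = cliqueIndex l) ∨ i = leftIndex m ∨ i = rightIndex m := by
  rcases lt_trichotomy (i : ℕ) m with h | h | h
  · exact Or.inl ⟨⟨i, h⟩, rfl⟩
  · exact Or.inr (Or.inl (Fin.ext h))
  · exact Or.inr (Or.inr (Fin.ext (by simp only [rightIndex]; omega)))

theorem mul_succ_bound {i l : ℕ} (h : i < l) :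
    (i : ℤ) * (K + 1) + (K + 1) ≤ l * (K + 1) := by
  have h2 : ((i + 1 : ℕ) : ℤ) ≤ l := by exact_mod_cast h
  push_cast at h2
  nlinarith [mul_le_mul_of_nonneg_right h2 (by positivity : (0 : ℤ) ≤ (K : ℤ) + 1)]

/-- Both inequalities are strict because a block has length `K + 1` and the offsets run from 1 to
`K`. Closed intervals meet when they touch, so this slack is what keeps clique interval `j` disjoint
from the outer ones. -/
theorem hardNumerator_clique_bounds (i : Fin m) :
    (i : ℤ) * (K + 1) < hardNumerator v j (cliqueIndex i) ∧
      hardNumerator v j (cliqueIndex i) < (i : ℤ) * (K + 1) + (K + 1) := by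
  rw [hardNumerator_clique]
  have := (v i).isLt
  constructor <;> omega

theorem hardNumerator_injective : Function.Injective (hardNumerator v j) := by
  have hj := mul_succ_bound (K := K) j.isLt
  have hj0 : (0 : ℤ) ≤ (j : ℤ) * (K + 1) := by positivity
  have hc : ∀ i : Fin m, 0 < hardNumerator v j (cliqueIndex i) ∧
      hardNumerator v j (cliqueIndex i) < m * (K + 1) := fun i => by
    have h1 := hardNumerator_clique_bounds v j i
    have h2 := mul_succ_bound (K := K) i.isLt
    have h0 : (0 : ℤ) ≤ (i : ℤ) * (K + 1) := by positivity
    omega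
  have hl := hardNumerator_left v j
  have hr := hardNumerator_right v j
  rw [add_mul, one_mul] at hr
  intro a b hab
  rcases index_cases a with ⟨i, rfl⟩ | rfl | rfl <;> rcases index_cases b with ⟨l, rfl⟩ | rfl | rfl
  · have hi := hardNumerator_clique_bounds v j i
    have hl := hardNumerator_clique_bounds v j l
    rcases lt_trichotomy i l with h | h | h
    · have := mul_succ_bound (K := K) h; omega
    · rw [h]
    · have := mul_succ_bound (K := K) h; omega
  · have := hc i; omega
  · have := hc i; omega
  · have := hc l; omega
  · rfl
  · omega
  · have := hc l; omega
  · omega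
  · rfl

theorem abs_hardNumerator_le (i : Fin (m + 2)) :
    |hardNumerator v j i| ≤ 2 * ((m : ℤ) * (K + 1)) := by
  have hj := mul_succ_bound (K := K) j.isLt
  have hj0 : (0 : ℤ) ≤ (j : ℤ) * (K + 1) := by positivity
  rw [abs_le]
  rcases index_cases i with ⟨i, rfl⟩ | rfl | rfl
  · have h1 := hardNumerator_clique_bounds v j i
    have h2 := mul_succ_bound (K := K) i.isLt
    have h0 : (0 : ℤ) ≤ (i : ℤ) * (K + 1) := by positivity
    omega
  · rw [hardNumerator_left]; omega
  · rw [hardNumerator_right, add_mul, one_mul]; omega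

/-- The left endpoints of the hard instance. -/
def hardLeft (i : Fin (m + 2)) : ℚ := (hardNumerator v j i : ℚ) / ((m * (K + 1) : ℕ) : ℚ)

theorem abs_hardLeft_sub_le_iff (v' : Fin m → Fin K) (i i' : Fin (m + 2)) :
    |hardLeft v j i - hardLeft v' j i'| ≤ 1 ↔
      |hardNumerator v j i - hardNumerator v' j i'| ≤ m * (K + 1) := by
  have hm : 0 < m := j.pos
  have hD : (0 : ℚ) < ((m * (K + 1) : ℕ) : ℚ) := by positivity
  rw [hardLeft, hardLeft, ← sub_div, abs_div, abs_of_pos hD, div_le_one hD]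
  exact_mod_cast Iff.rfl

theorem hardLeft_eq_divInt (i : Fin (m + 2)) :
    hardLeft v j i = Rat.divInt (hardNumerator v j i) ((m * (K + 1) : ℕ) : ℤ) := by
  rw [Rat.divInt_eq_div, hardLeft, Int.cast_natCast]

/-- The hard instance for the word `v` and the marked clique interval `j`. -/
def hardInstance (κ : ℕ) (hκ : 2 ≤ κ) (hm : 2 * (K + 1) ≤ m + 2) : Instance κ (m + 2) where
  left := ⟨hardLeft v j, fun a b hab => by
    have hm : 0 < m := j.pos
    have hD : ((m * (K + 1) : ℕ) : ℚ) ≠ 0 := by positivity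
    rw [hardLeft, hardLeft, div_left_inj' hD] at hab
    exact hardNumerator_injective v j (by exact_mod_cast hab)⟩
  num_le i := by
    have h0 : 0 < m := j.pos
    have h1 : 2 * ((m : ℤ) * (K + 1)) ≤ ((m + 2 : ℕ) : ℤ) ^ κ := by
      -- Numerators are at most twice the common denominator `m * (K + 1)`, which is quadratic in
      -- `n` at most; this is where `κ ≥ 2` suffices.
      have h2 : 2 * (m * (K + 1)) ≤ (m + 2) ^ κ :=
        calc 2 * (m * (K + 1)) ≤ (m + 2) ^ 2 := by nlinarith
          _ ≤ (m + 2) ^ κ := Nat.pow_le_pow_right (by omega) hκ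
      exact_mod_cast h2
    refine le_trans ?_ h1
    refine le_trans ?_ (abs_hardNumerator_le v j i)
    change |(hardLeft v j i).num| ≤ _
    -- The reduced numerator divides the unreduced one, which bounds it only if the latter is
    -- nonzero.
    by_cases hz : hardNumerator v j i = 0
    · simp [hardLeft, hz]
    · refine Int.le_of_dvd (abs_pos.2 hz) ?_
      rw [abs_dvd_abs]
      rw [hardLeft_eq_divInt]
      exact Rat.num_dvd _ (by positivity)
  den_le i := by
    have h0 : 0 < m := j.pos
    have h1 : m * (K + 1) ≤ (m + 2) ^ κ :=
      calc m * (K + 1) ≤ (m + 2) ^ 2 := by nlinarith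
        _ ≤ (m + 2) ^ κ := Nat.pow_le_pow_right (by omega) hκ
    refine le_trans ?_ h1
    change (hardLeft v j i).den ≤ _
    refine Nat.le_of_dvd (by positivity) ?_
    rw [hardLeft_eq_divInt]
    exact Int.natCast_dvd_natCast.1 (Rat.den_dvd _ _)

variable (κ : ℕ) (hκ : 2 ≤ κ) (hm : 2 * (K + 1) ≤ m + 2)

theorem mem_hardInstance {q : ℚ} :
    q ∈ (hardInstance v j κ hκ hm).intervals ↔ ∃ i, hardLeft v j i = q := by
  simp only [Instance.intervals, Finset.mem_map, Finset.mem_univ, true_and]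
  rfl

/-- Three classes of intervals: those not to the right of the left gap, the ones between the
gaps, and those not to the left of the right gap. -/
def gapClass (K : ℕ) (j : Fin m) (q : ℚ) : Fin 3 :=
  if q * ((m * (K + 1) : ℕ) : ℚ) ≤ (((j : ℤ) * (K + 1) : ℤ) : ℚ) then 0
  else if q * ((m * (K + 1) : ℕ) : ℚ) < (((j : ℤ) * (K + 1) + (K + 1) : ℤ) : ℚ) then 1 else 2

theorem gapClass_hardLeft (i : Fin (m + 2)) :
    gapClass K j (hardLeft v j i) =
      if hardNumerator v j i ≤ (j : ℤ) * (K + 1) then 0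
      else if hardNumerator v j i < (j : ℤ) * (K + 1) + (K + 1) then 1 else 2 := by
  have h0 : 0 < m := j.pos
  have hD : ((m * (K + 1) : ℕ) : ℚ) ≠ 0 := by positivity
  rw [gapClass, hardLeft, div_mul_cancel₀ _ hD]
  simp only [Int.cast_le, Int.cast_lt]

theorem eq_cliqueIndex_of_gapClass {i : Fin (m + 2)} (h : gapClass K j (hardLeft v j i) = 1) :
    i = cliqueIndex j := by
  rw [gapClass_hardLeft] at h
  have hj := mul_succ_bound (K := K) j.isLt
  have hj0 : (0 : ℤ) ≤ (j : ℤ) * (K + 1) := by positivity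
  split_ifs at h with h1 h2
  · simp at h
  · rcases index_cases i with ⟨i, rfl⟩ | rfl | rfl
    · have hi := hardNumerator_clique_bounds v j i
      rcases lt_trichotomy i j with h | h | h
      · have := mul_succ_bound (K := K) h; omega
      · rw [h]
      · have := mul_succ_bound (K := K) h; omega
    · rw [hardNumerator_left] at h1; omega
    · rw [hardNumerator_right, add_mul, one_mul] at h2; omega
  · simp at h

theorem hardNumerator_mem_Icc (i : Fin (m + 2)) :
    (j : ℤ) * (K + 1) - m * (K + 1) ≤ hardNumerator v j i ∧
      hardNumerator v j i ≤ (j : ℤ) * (K + 1) + (K + 1) + m * (K + 1) := by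
  have hj := mul_succ_bound (K := K) j.isLt
  have hj0 : (0 : ℤ) ≤ (j : ℤ) * (K + 1) := by positivity
  rcases index_cases i with ⟨i, rfl⟩ | rfl | rfl
  · have h1 := hardNumerator_clique_bounds v j i
    have h2 := mul_succ_bound (K := K) i.isLt
    have h0 : (0 : ℤ) ≤ (i : ℤ) * (K + 1) := by positivity
    omega
  · rw [hardNumerator_left]; omega
  · rw [hardNumerator_right, add_mul, one_mul]; omega

/-- The middle class is a single interval. The left endpoints in each other class lie in a window of
length one, reaching from the marked block out to an outer interval, so each class is a clique. -/
theorem abs_hardLeft_sub_le_of_gapClass_eq {i i' : Fin (m + 2)}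
    (h : gapClass K j (hardLeft v j i) = gapClass K j (hardLeft v j i')) :
    |hardLeft v j i - hardLeft v j i'| ≤ 1 := by
  by_cases h1 : gapClass K j (hardLeft v j i) = 1
  · rw [eq_cliqueIndex_of_gapClass v j h1, eq_cliqueIndex_of_gapClass v j (h.symm.trans h1)]
    simp
  · rw [abs_hardLeft_sub_le_iff, abs_le]
    have hi := hardNumerator_mem_Icc v j i
    have hi' := hardNumerator_mem_Icc v j i'
    rw [gapClass_hardLeft] at h h1
    rw [gapClass_hardLeft] at h
    split_ifs at h h1 <;> simp_all <;> omega

theorem gapClass_injOn {I : Finset ℚ} (hI : Feasible (hardInstance v j κ hκ hm).intervals I) :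
    Set.InjOn (gapClass K j) I := by
  intro a ha b hb hab
  obtain ⟨i, rfl⟩ := (mem_hardInstance v j κ hκ hm).1 (hI.1 ha)
  obtain ⟨i', rfl⟩ := (mem_hardInstance v j κ hκ hm).1 (hI.1 hb)
  exact hI.2.eq_of_abs_sub_le ha hb (abs_hardLeft_sub_le_of_gapClass_eq v j hab)

theorem card_le_three {I : Finset ℚ} (hI : Feasible (hardInstance v j κ hκ hm).intervals I) :
    I.card ≤ 3 := by
  have := Finset.card_le_card_of_injOn (s := I) (t := Finset.univ) (gapClass K j)
    (fun _ _ => Finset.mem_coe.2 (Finset.mem_univ _)) (gapClass_injOn v j κ hκ hm hI)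
  simpa using this

theorem mem_of_card_eq_three {I : Finset ℚ}
    (hI : Feasible (hardInstance v j κ hκ hm).intervals I) (h3 : I.card = 3) :
    hardLeft v j (cliqueIndex j) ∈ I := by
  have himg : I.image (gapClass K j) = Finset.univ := by
    rw [← Finset.card_eq_iff_eq_univ, Finset.card_image_of_injOn (gapClass_injOn v j κ hκ hm hI),
      h3, Fintype.card_fin]
  obtain ⟨q, hq, hq1⟩ := Finset.mem_image.1 (himg ▸ Finset.mem_univ (1 : Fin 3))
  obtain ⟨i, rfl⟩ := (mem_hardInstance v j κ hκ hm).1 (hI.1 hq)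
  rwa [← eq_cliqueIndex_of_gapClass v j hq1]

theorem alpha_hardInstance : alpha (hardInstance v j κ hκ hm).intervals = 3 := by
  classical
  apply le_antisymm
  · refine Finset.sup_le fun I hI => ?_
    simp only [Finset.mem_filter, Finset.mem_powerset] at hI
    exact card_le_three v j κ hκ hm hI
  · have hj := hardNumerator_clique_bounds v j j
    have hl := hardNumerator_left v j
    have hr := hardNumerator_right v j
    rw [add_mul, one_mul] at hr
    have hD : (0 : ℤ) ≤ (m : ℤ) * (K + 1) := by positivity
    have h1 : 1 < |hardLeft v j (leftIndex m) - hardLeft v j (cliqueIndex j)| := by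
      rw [← not_le, abs_hardLeft_sub_le_iff, abs_le]; omega
    have h2 : 1 < |hardLeft v j (leftIndex m) - hardLeft v j (rightIndex m)| := by
      rw [← not_le, abs_hardLeft_sub_le_iff, abs_le]; omega
    have h3 : 1 < |hardLeft v j (cliqueIndex j) - hardLeft v j (rightIndex m)| := by
      rw [← not_le, abs_hardLeft_sub_le_iff, abs_le]; omega
    let I : Finset ℚ := {hardLeft v j (leftIndex m), hardLeft v j (cliqueIndex j),
      hardLeft v j (rightIndex m)}
    have hne : ∀ {a b : ℚ}, 1 < |a - b| → a ≠ b := by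
      rintro a _ h rfl
      simp at h
      linarith
    have hI : I.card = 3 := Finset.card_eq_three.2 ⟨_, _, _, hne h1, hne h2, hne h3, rfl⟩
    rw [← hI, alpha]
    refine Finset.le_sup (f := Finset.card) ?_
    simp only [Finset.mem_filter, Finset.mem_powerset]
    constructor
    · intro q hq
      simp only [I, Finset.mem_insert, Finset.mem_singleton] at hq
      rw [mem_hardInstance]
      rcases hq with rfl | rfl | rfl <;> exact ⟨_, rfl⟩
    · intro a ha b hb hab
      simp only [I, Finset.coe_insert, Finset.coe_singleton, Set.mem_insert_iff,
        Set.mem_singleton_iff] at ha hb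
      refine disjoint_closedUnitInterval_iff.2 ?_
      rcases ha with rfl | rfl | rfl <;> rcases hb with rfl | rfl | rfl <;>
        first
        | exact absurd rfl hab
        | assumption
        | (rw [abs_sub_comm]; assumption)

/-- A solution of size three determines the letter of the word at the marked position. -/
theorem letter_eq_of_card_eq_three (v' : Fin m → Fin K) {I : Finset ℚ} (h3 : I.card = 3)
    (hI : Feasible (hardInstance v j κ hκ hm).intervals I)
    (hI' : Feasible (hardInstance v' j κ hκ hm).intervals I) : v j = v' j := by
  have h0 : 0 < m := j.pos
  have h := mem_of_card_eq_three v j κ hκ hm hI h3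
  have h' := mem_of_card_eq_three v' j κ hκ hm hI' h3
  have hj := hardNumerator_clique_bounds v j j
  have hj' := hardNumerator_clique_bounds v' j j
  have hD : (K : ℤ) + 1 ≤ m * (K + 1) := by
    have := mul_succ_bound (K := K) h0
    simpa using this
  -- `I` contains clique interval `j` of both instances. Both start in the same block, which is no
  -- longer than a unit, so they meet, and independence of `I` makes them equal.
  have heq := hI.2.eq_of_abs_sub_le h h' (by
    rw [abs_hardLeft_sub_le_iff, abs_le]; omega)
  have hD' : ((m * (K + 1) : ℕ) : ℚ) ≠ 0 := by positivity
  rw [hardLeft, hardLeft, div_left_inj' hD', Int.cast_inj, hardNumerator_clique,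
    hardNumerator_clique] at heq
  exact Fin.ext (by omega)

end

end IntervalSelection

namespace IntervalSelection

variable {Ω : Type*} [MeasurableSpace Ω]

/-- On the stream of `x` in the order `σ` and with the random choices `ω`, the algorithm outputs
a solution of size three. -/
def FindsThree (A : StreamingAlgorithm Ω) {κ n : ℕ} (x : Instance κ n)
    (σ : Equiv.Perm (Fin n)) (ω : Ω) : Prop :=
  Feasible x.intervals (A.result (x.stream σ) ω) ∧ (A.result (x.stream σ) ω).card = 3

theorem measurableSet_findsThree (A : StreamingAlgorithm Ω) {κ n : ℕ} (x : Instance κ n)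
    (σ : Equiv.Perm (Fin n)) : MeasurableSet {ω | FindsThree A x σ ω} :=
  A.measurableSet_result (x.stream σ) fun I => Feasible x.intervals I ∧ I.card = 3

/-! ### Fixed random choices: counting the solutions of size three -/

section Deterministic

variable {K m : ℕ} {κ : ℕ} (hκ : 2 ≤ κ)

theorem hardNumerator_congr {v v' : Fin m → Fin K} {j : Fin m} {i : Fin (m + 2)}
    (h : ∀ l, i = cliqueIndex l → v l = v' l) : hardNumerator v j i = hardNumerator v' j i := by
  rcases index_cases i with ⟨l, rfl⟩ | rfl | rfl
  · rw [hardNumerator_clique, hardNumerator_clique, h l rfl]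
  · rw [hardNumerator_left, hardNumerator_left]
  · rw [hardNumerator_right, hardNumerator_right]

/-- The clique intervals that arrive before the two other intervals. -/
def earlyClique (σ : Equiv.Perm (Fin (m + 2))) : Finset (Fin m) :=
  Finset.univ.filter fun j => σ.symm (cliqueIndex j) < σ.symm (leftIndex m) ∧
    σ.symm (cliqueIndex j) < σ.symm (rightIndex m)

open Classical in
/-- The early clique intervals that the algorithm finds when they are marked. -/
noncomputable def earlyFound (A : StreamingAlgorithm Ω) (hm : 2 * (K + 1) ≤ m + 2) (ω : Ω)
    (σ : Equiv.Perm (Fin (m + 2))) (v : Fin m → Fin K) : Finset (Fin m) :=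
  (earlyClique σ).filter fun j => FindsThree A (hardInstance v j κ hκ hm) σ ω

/-- The early part of the stream does not depend on the marked position. -/
theorem memory_hardInstance_eq (A : StreamingAlgorithm Ω) (hm : 2 * (K + 1) ≤ m + 2) (ω : Ω)
    (σ : Equiv.Perm (Fin (m + 2))) (v : Fin m → Fin K) (j j' : Fin m) {t : ℕ}
    (htl : t ≤ σ.symm (leftIndex m)) (htr : t ≤ σ.symm (rightIndex m)) :
    A.memory ((hardInstance v j κ hκ hm).stream σ) ω t =
      A.memory ((hardInstance v j' κ hκ hm).stream σ) ω t := by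
  refine A.memory_congr ω t fun i hi => ?_
  change hardLeft v j (σ i) = hardLeft v j' (σ i)
  rw [hardLeft, hardLeft]
  rcases index_cases (σ i) with ⟨l, hl⟩ | hl | hl
  · rw [hl, hardNumerator_clique, hardNumerator_clique]
  · rw [← hl, Equiv.symm_apply_apply] at htl; omega
  · rw [← hl, Equiv.symm_apply_apply] at htr; omega

-- The word is decoded as follows. For `j` in `earlyFound`, the run on the instance marked at `j`
-- can be completed from the memory content at time `t` and the letters off `earlyFound`, and its
-- output reveals the letter at `j`.
open Classical in
theorem mul_sum_card_earlyFound_le {k : ℕ} (A : StreamingAlgorithm Ω)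
    (hm : 2 * (2 ^ k + 1) ≤ m + 2) (ω : Ω) (σ : Equiv.Perm (Fin (m + 2))) (j₀ : Fin m)
    (hlen : ∀ (v : Fin m → Fin (2 ^ k)) (j : Fin m), ∀ t ≤ m + 2,
      (A.memory ((hardInstance v j κ hκ hm).stream σ) ω t).length ≤ m) :
    k * ∑ v, (earlyFound hκ A hm ω σ v).card ≤ (3 * m + 1) * (2 ^ k) ^ m := by
  -- The arrival time of the first outer interval: every early clique interval comes before it, and
  -- nothing before it depends on the marked position.
  let t : ℕ := min (σ.symm (leftIndex m) : ℕ) (σ.symm (rightIndex m) : ℕ)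
  have htl : t ≤ σ.symm (leftIndex m) := min_le_left _ _
  have htr : t ≤ σ.symm (rightIndex m) := min_le_right _ _
  have htn : t ≤ m + 2 := htl.trans (σ.symm (leftIndex m)).isLt.le
  have hQ : Fintype.card (Fin m → Option Bool) ≤ 4 ^ m := by
    simp only [Fintype.card_pi, Fintype.card_option, Fintype.card_bool, Finset.prod_const,
      Finset.card_univ, Fintype.card_fin]
    exact Nat.pow_le_pow_left (by norm_num) m
  refine mul_sum_card_le hQ
    (fun v => firstBits m (A.memory ((hardInstance v j₀ κ hκ hm).stream σ) ω t)) _ ?_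
  intro v v' hf hG hoff
  funext j
  by_cases hj : j ∈ earlyFound hκ A hm ω σ v
  · have hj' := hj
    rw [hG] at hj'
    have hmem : A.memory ((hardInstance v j κ hκ hm).stream σ) ω t =
        A.memory ((hardInstance v' j κ hκ hm).stream σ) ω t := by
      rw [memory_hardInstance_eq hκ A hm ω σ v j j₀ htl htr,
        memory_hardInstance_eq hκ A hm ω σ v' j j₀ htl htr]
      exact firstBits_injOn (hlen v j₀ t htn) (hlen v' j₀ t htn) hf
    have hres : A.result ((hardInstance v j κ hκ hm).stream σ) ω =
        A.result ((hardInstance v' j κ hκ hm).stream σ) ω := by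
      rw [StreamingAlgorithm.result, StreamingAlgorithm.result]
      congr 1
      refine A.memory_congr_of_le ω htn hmem fun i hi => ?_
      change hardLeft v j (σ i) = hardLeft v' j (σ i)
      rw [hardLeft, hardLeft, hardNumerator_congr]
      intro l hl
      -- A clique interval arriving from time `t` on is not early, so its letter is among those
      -- known to agree.
      refine hoff l fun hlG => ?_
      have hlT := (Finset.mem_filter.1 hlG).1
      simp only [earlyClique, Finset.mem_filter, Finset.mem_univ, true_and, ← hl,
        Equiv.symm_apply_apply, Fin.lt_def] at hlT
      omega
    have h1 := (Finset.mem_filter.1 hj).2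
    have h2 := (Finset.mem_filter.1 hj').2
    rw [FindsThree, ← hres] at h2
    exact letter_eq_of_card_eq_three v j κ hκ hm v' h1.2 h1.1 h2.1
  · exact hoff j hj

/-- After exchanging the sums, each clique interval is late in at most 2/3 of the orders. -/
theorem three_mul_sum_card_compl_earlyClique_le :
    3 * ∑ σ : Equiv.Perm (Fin (m + 2)), (earlyClique σ)ᶜ.card ≤ m * (2 * (m + 2).factorial) := by
  have h : ∑ σ : Equiv.Perm (Fin (m + 2)), (earlyClique σ)ᶜ.card = ∑ j : Fin m,
      (Finset.univ.filter fun σ : Equiv.Perm (Fin (m + 2)) =>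
        ¬ (σ.symm (cliqueIndex j) < σ.symm (leftIndex m) ∧
          σ.symm (cliqueIndex j) < σ.symm (rightIndex m))).card := by
    simp only [earlyClique, Finset.compl_filter, Finset.card_filter]
    exact Finset.sum_comm
  rw [h, Finset.mul_sum]
  refine (Finset.sum_le_sum fun j _ => three_mul_card_not_first_le ?_ ?_ ?_).trans ?_
  · simp [cliqueIndex, leftIndex, Fin.ext_iff, j.isLt.ne]
  · have := j.isLt
    simp only [cliqueIndex, rightIndex, ne_eq, Fin.ext_iff, Fin.val_castAdd]
    omega
  · simp [leftIndex, rightIndex]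
  · simp

open Classical in
/-- A deterministic algorithm with memory contents of at most `m` bits finds few of the
solutions of size three. -/
theorem sum_card_findsThree_le {k : ℕ} (hk : 0 < k) (A : StreamingAlgorithm Ω)
    (hm : 2 * (2 ^ k + 1) ≤ m + 2) (ω : Ω) (j₀ : Fin m)
    (hlen : ∀ (σ : Equiv.Perm (Fin (m + 2))) (v : Fin m → Fin (2 ^ k)) (j : Fin m), ∀ t ≤ m + 2,
      (A.memory ((hardInstance v j κ hκ hm).stream σ) ω t).length ≤ m) :
    ((∑ σ, ∑ v, (Finset.univ.filter fun j =>
      FindsThree A (hardInstance v j κ hκ hm) σ ω).card : ℕ) : ℝ) ≤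
      (m + 2).factorial * (2 ^ k) ^ m * (2 / 3 * m + (3 * m + 1) / k) := by
  -- Success is conceded at every late marked position.
  have h1 : ∀ σ v, (Finset.univ.filter fun j =>
      FindsThree A (hardInstance v j κ hκ hm) σ ω).card ≤
        (earlyClique σ)ᶜ.card + (earlyFound hκ A hm ω σ v).card := by
    intro σ v
    refine (Finset.card_le_card fun j hj => ?_).trans (Finset.card_union_le _ _)
    by_cases hjT : j ∈ earlyClique σ
    · exact Finset.mem_union_right _ (Finset.mem_filter.2 ⟨hjT, (Finset.mem_filter.1 hj).2⟩)
    · exact Finset.mem_union_left _ (Finset.mem_compl.2 hjT)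
  have h2 := Finset.sum_le_sum fun σ (_ : σ ∈ Finset.univ) =>
    Finset.sum_le_sum fun v (_ : v ∈ Finset.univ) => h1 σ v
  simp only [Finset.sum_add_distrib, Finset.sum_const, Finset.card_univ, Fintype.card_pi,
    Fintype.card_fin, Finset.prod_const, smul_eq_mul, ← Finset.mul_sum] at h2
  have h3 := three_mul_sum_card_compl_earlyClique_le (m := m)
  have h4 : k * ∑ σ, ∑ v, (earlyFound hκ A hm ω σ v).card ≤
      (m + 2).factorial * ((3 * m + 1) * (2 ^ k) ^ m) := by
    rw [Finset.mul_sum]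
    refine (Finset.sum_le_sum fun σ _ =>
      mul_sum_card_earlyFound_le hκ A hm ω σ j₀ (hlen σ)).trans ?_
    simp [Fintype.card_perm]
  have h2' := (Nat.cast_le (α := ℝ)).2 h2
  have h3' := (Nat.cast_le (α := ℝ)).2 h3
  have h4' := (Nat.cast_le (α := ℝ)).2 h4
  refine h2'.trans ?_
  have hk' : (0 : ℝ) < k := by exact_mod_cast hk
  rw [Nat.cast_mul] at h3' h4'
  rw [Nat.cast_add, Nat.cast_mul, mul_add]
  refine add_le_add ?_ ?_
  · have hK : (0 : ℝ) ≤ (2 ^ k) ^ m := by positivity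
    have h5 := mul_le_mul_of_nonneg_left h3' hK
    push_cast at h5 ⊢
    linarith
  · rw [mul_div_assoc', le_div_iff₀ hk']
    push_cast at h4' ⊢
    linarith

end Deterministic

/-! ### Averaging over random choices, and the two measures of quality -/

section Randomized

variable (P : Measure Ω) [IsProbabilityMeasure P]

/-- The probability that the output is a solution of size three. -/
noncomputable def probFindsThree (A : StreamingAlgorithm Ω) {κ n : ℕ} (x : Instance κ n) : ℝ :=
  (∑ σ : Equiv.Perm (Fin n), P.real {ω | FindsThree A x σ ω}) / (n.factorial : ℝ)

/-- If every hard instance were solved with probability at least `2 / 3 + ε`, so would be the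
average over words and marked positions; exchanging sum and integral contradicts the bound for fixed
`ω`. -/
theorem exists_probFindsThree_lt (A : StreamingAlgorithm Ω) {ε : ℝ} {k m κ : ℕ}
    (hk : 4 < ε * k) (hk0 : 0 < k) (hκ : 2 ≤ κ) (hm2 : 2 ≤ m) (hm : 2 * (2 ^ k + 1) ≤ m + 2)
    (hspace : ∀ x : Instance κ (m + 2), alpha x.intervals = 3 →
      ¬ A.UsesSpaceAtLeast P x (1 / 2 * ((m + 2 : ℕ) : ℝ))) :
    ∃ x : Instance κ (m + 2), (alpha x.intervals = 3 ∧ ∀ I, Feasible x.intervals I → I.card ≤ 3) ∧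
      probFindsThree P A x < 2 / 3 + ε := by
  classical
  by_contra! hcon
  have hx : ∀ (v : Fin m → Fin (2 ^ k)) (j : Fin m), (2 / 3 + ε) * (m + 2).factorial ≤
      ∑ σ, P.real {ω | FindsThree A (hardInstance v j κ hκ hm) σ ω} := by
    intro v j
    have := hcon (hardInstance v j κ hκ hm) ⟨alpha_hardInstance v j κ hκ hm,
      fun I hI => card_le_three v j κ hκ hm hI⟩
    rwa [probFindsThree, le_div_iff₀ (by positivity)] at this
  -- Only countably many orders, words, positions and times occur, so one null set covers every
  -- violation of the space bound.
  have hlen : ∀ᵐ ω ∂P, ∀ (σ : Equiv.Perm (Fin (m + 2))) (v : Fin m → Fin (2 ^ k)) (j : Fin m)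
      (t : ℕ), t ≤ m + 2 → (A.memory ((hardInstance v j κ hκ hm).stream σ) ω t).length ≤ m := by
    simp only [ae_all_iff]
    intro σ v j t ht
    have h0 := hspace (hardInstance v j κ hκ hm) (alpha_hardInstance v j κ hκ hm)
    rw [StreamingAlgorithm.UsesSpaceAtLeast] at h0
    push Not at h0
    have h1 := nonpos_iff_eq_zero.1 (h0 σ t ht)
    filter_upwards [measure_eq_zero_iff_ae_notMem.1 h1] with ω hω
    have h2 : ((A.memory ((hardInstance v j κ hκ hm).stream σ) ω t).length : ℝ) <
        1 / 2 * ((m + 2 : ℕ) : ℝ) := not_le.1 hω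
    have h3 : 2 * (A.memory ((hardInstance v j κ hκ hm).stream σ) ω t).length < m + 2 := by
      have : (2 : ℝ) * (A.memory ((hardInstance v j κ hκ hm).stream σ) ω t).length <
        ((m + 2 : ℕ) : ℝ) := by linarith
      exact_mod_cast this
    omega
  let F : Equiv.Perm (Fin (m + 2)) → (Fin m → Fin (2 ^ k)) → Fin m → Set Ω := fun σ v j =>
    {ω | FindsThree A (hardInstance v j κ hκ hm) σ ω}
  have hF : ∀ σ v j, MeasurableSet (F σ v j) := fun σ v j => measurableSet_findsThree A _ σ
  have hint : ∀ σ v j, Integrable ((F σ v j).indicator (1 : Ω → ℝ)) P := fun σ v j =>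
    (integrable_indicator_iff (hF σ v j)).2 (integrable_const (1 : ℝ)).integrableOn
  have hsum : ∑ σ, ∑ v, ∑ j, P.real (F σ v j) =
      ∫ ω, ∑ σ, ∑ v, ∑ j, (F σ v j).indicator (1 : Ω → ℝ) ω ∂P := by
    rw [integral_finsetSum _ fun σ _ => integrable_finsetSum _ fun v _ =>
      integrable_finsetSum _ fun j _ => hint σ v j]
    refine Finset.sum_congr rfl fun σ _ => ?_
    rw [integral_finsetSum _ fun v _ => integrable_finsetSum _ fun j _ => hint σ v j]
    refine Finset.sum_congr rfl fun v _ => ?_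
    rw [integral_finsetSum _ fun j _ => hint σ v j]
    exact Finset.sum_congr rfl fun j _ => (integral_indicator_one (hF σ v j)).symm
  have hupper : ∑ σ, ∑ v, ∑ j, P.real (F σ v j) ≤
      (m + 2).factorial * (2 ^ k) ^ m * (2 / 3 * m + (3 * m + 1) / k) := by
    rw [hsum]
    refine (integral_mono_ae (integrable_finsetSum _ fun σ _ => integrable_finsetSum _
      fun v _ => integrable_finsetSum _ fun j _ => hint σ v j) (integrable_const
      (((m + 2).factorial : ℝ) * (2 ^ k) ^ m * (2 / 3 * m + (3 * m + 1) / k))) ?_).trans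
      (by simp)
    filter_upwards [hlen] with ω hω
    refine le_trans (le_of_eq ?_) (sum_card_findsThree_le hκ hk0 A hm ω ⟨0, by omega⟩ hω)
    simp [F, Set.indicator_apply]
  have hlower : (2 ^ k) ^ m * (m * ((2 / 3 + ε) * (m + 2).factorial)) ≤
      ∑ σ, ∑ v, ∑ j, P.real (F σ v j) := by
    rw [Finset.sum_comm]
    simp only [Finset.sum_comm (s := (Finset.univ : Finset (Equiv.Perm (Fin (m + 2)))))]
    refine le_trans (le_of_eq ?_)
      (Finset.sum_le_sum fun v _ => Finset.sum_le_sum fun j _ => hx v j)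
    simp
  have hle := hlower.trans hupper
  have hpos : (0 : ℝ) < (m + 2).factorial * (2 ^ k) ^ m := by positivity
  have hle' : (2 / 3 + ε) * m ≤ 2 / 3 * m + (3 * m + 1) / k := by
    refine le_of_mul_le_mul_left ?_ hpos
    linarith
  have hk' : (0 : ℝ) < k := by exact_mod_cast hk0
  have hm' : (2 : ℝ) ≤ m := by exact_mod_cast hm2
  have h5 : ε * m ≤ (3 * m + 1) / k := by linarith
  rw [le_div_iff₀ hk'] at h5
  -- With `4 < ε * k`, the inequality `ε * m * k ≤ 3 * m + 1` would give `4 * m < 3 * m + 1`.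
  nlinarith

/-- With optimum three, a factor above 2/3 forces size above two, hence exactly three. -/
theorem successProb_le_probFindsThree (A : StreamingAlgorithm Ω) {κ n : ℕ} {x : Instance κ n}
    (hx : alpha x.intervals = 3) (h3 : ∀ I, Feasible x.intervals I → I.card ≤ 3) {δ : ℝ}
    (hδ : 0 < δ) : A.successProb P (2 / 3 + δ) x ≤ probFindsThree P A x := by
  rw [StreamingAlgorithm.successProb, probFindsThree]
  gcongr with σ _
  · exact measure_ne_top _ _
  · rename_i ω
    rintro ⟨hf, hc⟩
    refine ⟨hf, le_antisymm (h3 _ hf) ?_⟩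
    rw [hx] at hc
    have : (2 : ℝ) < (A.result (x.stream σ) ω).card := by push_cast at hc; linarith
    exact_mod_cast this

/-- Pointwise the factor is at most 2/3, except for 1 when a solution of size three is found. -/
theorem expectedFactor_le (A : StreamingAlgorithm Ω) {κ n : ℕ} {x : Instance κ n}
    (hx : alpha x.intervals = 3) (h3 : ∀ I, Feasible x.intervals I → I.card ≤ 3) :
    A.expectedFactor P x ≤ 2 / 3 + 1 / 3 * probFindsThree P A x := by
  classical
  have hfac : (0 : ℝ) < n.factorial := by positivity
  have hσ : ∀ σ : Equiv.Perm (Fin n), ∫ ω, approxFactor x.intervals (A.result (x.stream σ) ω) ∂P ≤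
      2 / 3 + 1 / 3 * P.real {ω | FindsThree A x σ ω} := by
    intro σ
    have hS := measurableSet_findsThree A x σ
    have hint : Integrable ({ω | FindsThree A x σ ω}.indicator (1 : Ω → ℝ)) P :=
      (integrable_indicator_iff hS).2 (integrable_const (1 : ℝ)).integrableOn
    have e : ∫ ω, (2 / 3 + 1 / 3 * {ω | FindsThree A x σ ω}.indicator (1 : Ω → ℝ) ω) ∂P =
        2 / 3 + 1 / 3 * P.real {ω | FindsThree A x σ ω} := by
      rw [integral_add (integrable_const _) (hint.const_mul _), integral_const_mul,
        integral_indicator_one hS]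
      simp
    rw [← e]
    refine integral_mono_of_nonneg (Filter.Eventually.of_forall fun ω => ?_)
      ((integrable_const _).add (hint.const_mul _)) (Filter.Eventually.of_forall fun ω => ?_)
    · simp only [approxFactor, Pi.zero_apply]
      split_ifs <;> positivity
    · simp only [approxFactor, hx, Set.indicator_apply, Set.mem_ofPred_eq, Pi.one_apply]
      by_cases hf : Feasible x.intervals (A.result (x.stream σ) ω)
      · rw [if_pos hf]
        by_cases hc : (A.result (x.stream σ) ω).card = 3
        · rw [if_pos ⟨hf, hc⟩, hc]; norm_num
        · rw [if_neg fun h => hc h.2]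
          have h2 : (A.result (x.stream σ) ω).card ≤ 2 := by
            have := h3 _ hf; omega
          have h2' : ((A.result (x.stream σ) ω).card : ℝ) ≤ 2 := by exact_mod_cast h2
          push_cast
          linarith
      · rw [if_neg hf, if_neg fun h => hf h.1]; norm_num
  rw [StreamingAlgorithm.expectedFactor, probFindsThree, div_le_iff₀ hfac]
  refine (Finset.sum_le_sum fun σ _ => hσ σ).trans (le_of_eq ?_)
  rw [Finset.sum_add_distrib, ← Finset.mul_sum, add_mul, mul_assoc (1 / 3),
    div_mul_cancel₀ _ hfac.ne']
  simp [Fintype.card_perm, mul_comm]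

end Randomized

/-- For `n` large enough in terms of `ε`, an algorithm that uses less than `n / 2` bits of space
finds the solution of size three of some instance with probability less than `2 / 3 + ε`. -/
theorem exists_threshold {ε : ℝ} (hε : 0 < ε) : ∃ N : ℕ, ∀ n : ℕ, N ≤ n → ∀ κ : ℕ, 2 ≤ κ →
    ∀ (Ω : Type*) [MeasurableSpace Ω] (P : Measure Ω) [IsProbabilityMeasure P]
      (A : StreamingAlgorithm Ω),
      (∀ x : Instance κ n, alpha x.intervals = 3 →
        ¬ A.UsesSpaceAtLeast P x (1 / 2 * (n : ℝ))) →
      ∃ x : Instance κ n,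
        (alpha x.intervals = 3 ∧ ∀ I, Feasible x.intervals I → I.card ≤ 3) ∧
          probFindsThree P A x < 2 / 3 + ε := by
  obtain ⟨k, hk⟩ := exists_nat_gt (4 / ε)
  have hk0 : 0 < k := by
    have : (0 : ℝ) < k := lt_trans (by positivity) hk
    exact_mod_cast this
  rw [div_lt_iff₀' hε] at hk
  -- This size of `n` is what the bound on numerators and denominators of the hard instance requires
  -- for an alphabet of size `2 ^ k`.
  refine ⟨2 * (2 ^ k + 1), fun n hn κ hκ Ω _ P _ A hA => ?_⟩
  have hK : 1 ≤ 2 ^ k := Nat.one_le_two_pow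
  obtain ⟨m, rfl⟩ : ∃ m, n = m + 2 := ⟨n - 2, by omega⟩
  exact exists_probFindsThree_lt P A hk hk0 hκ (by omega) hn hA

end IntervalSelection

theorem theorem2 (ε : ℝ) (hε : 0 < ε) :
    (∃ c : ℝ, 0 < c ∧ ∃ N : ℕ, ∀ n : ℕ, N ≤ n → ∀ κ : ℕ, 2 ≤ κ →
      ∀ (Ω : Type*) [MeasurableSpace Ω] (P : Measure Ω) [IsProbabilityMeasure P]
        (A : IntervalSelection.StreamingAlgorithm Ω),
        (∀ x : IntervalSelection.Instance κ n, 8 / 9 + ε ≤ A.expectedFactor P x) →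
        ∃ x : IntervalSelection.Instance κ n,
          IntervalSelection.alpha x.intervals = 3 ∧ A.UsesSpaceAtLeast P x (c * (n : ℝ))) ∧
    (∃ c : ℝ, 0 < c ∧ ∃ N : ℕ, ∀ n : ℕ, N ≤ n → ∀ κ : ℕ, 2 ≤ κ → ∀ δ : ℝ, 0 < δ →
      ∀ (Ω : Type*) [MeasurableSpace Ω] (P : Measure Ω) [IsProbabilityMeasure P]
        (A : IntervalSelection.StreamingAlgorithm Ω),
        (∀ x : IntervalSelection.Instance κ n, 2 / 3 + ε ≤ A.successProb P (2 / 3 + δ) x) →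
        ∃ x : IntervalSelection.Instance κ n,
          IntervalSelection.alpha x.intervals = 3 ∧ A.UsesSpaceAtLeast P x (c * (n : ℝ))) := by
  refine ⟨⟨1 / 2, by norm_num, ?_⟩, ⟨1 / 2, by norm_num, ?_⟩⟩
  · obtain ⟨N, hN⟩ := IntervalSelection.exists_threshold hε
    refine ⟨N, fun n hn κ hκ Ω _ P _ A hA => ?_⟩
    by_contra! hcon
    obtain ⟨x, ⟨hx, h3⟩, hlt⟩ := hN n hn κ hκ Ω P A hcon
    have h1 := hA x
    have h2 := IntervalSelection.expectedFactor_le P A hx h3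
    -- `2/3 + (2/3 + ε) / 3 = 8/9 + ε / 3`, which is less than `8/9 + ε`.
    linarith
  · obtain ⟨N, hN⟩ := IntervalSelection.exists_threshold hε
    refine ⟨N, fun n hn κ hκ δ hδ Ω _ P _ A hA => ?_⟩
    by_contra! hcon
    obtain ⟨x, ⟨hx, h3⟩, hlt⟩ := hN n hn κ hκ Ω P A hcon
    have h1 := hA x
    have h2 := IntervalSelection.successProb_le_probFindsThree P A hx h3 hδ
    linarith
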